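/- Let $n\ge 1$, $p\in(1,\infty)$ and $w\in A_p(\mathbb{R}^n)$, i.e. $w$ is locally integrable, positive almost everywhere, and $$\sup_Q\Big(\frac1{|Q|}\int_Q w(x)\,dx\Big)\Big(\frac1{|Q|}\int_Q w(x)^{-\frac1{p-1}}\,dx\Big)^{p-1}<\infty,$$ the supremum being taken over all cubes $Q\subset\mathbb{R}^n$ with sides parallel to the axes. Write $\|F\|_{L^p(\mathbb{R}^n,w)}=\big(\int_{\mathbb{R}^n}|F(x)|^pw(x)\,dx\big)^{1/p}$. Let $L^p(L^2([1,2]),\ell^2;\mathbb{R}^n,w)$ be the normed space (modulo equality almost everywhere) of all sequences $\vec f=\{f_k\}_{k\in\mathbb{Z}}$ of measurable functions $f_k:\mathbb{R}^n\times[1,2]\to\mathbb{C}$ with $$\|\vec f\|_{L^p(L^2([1,2]),\ell^2;\mathbb{R}^n,w)}=\Big\|\Big(\int_1^2\sum_{k\in\mathbb{Z}}|f_k(\cdot,t)|^2\,dt\Big)^{1/2}\Big\|_{L^p(\mathbb{R}^n,w)}<\infty .$$ Let $\mathcal{G}$ be a set of such sequences of functions, with the following five properties. (a) $\mathcal{G}$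 is bounded: there is a constant $C$ with $\|\vec f\|_{L^p(L^2([1,2]),\ell^2;\mathbb{R}^n,w)}\le C$ for all $\vec f\in\mathcal{G}$. (b) For each $\epsilon>0$ there is $A>0$ such that for all $\vec f\in\mathcal{G}$, $$\Big\|\Big(\int_1^2\sum_{k\in\mathbb{Z}}|f_k(\cdot,t)|^2\,dt\Big)^{1/2}\chi_{\{|\cdot|>A\}}\Big\|_{L^p(\mathbb{R}^n,w)}<\epsilon .$$ (c) For each $\epsilon>0$ and $N\in\mathbb{N}$ there is $\varrho>0$ such that for all $\vec f\in\mathcal{G}$, $$\Big\|\sup_{|h|\le\varrho}\Big(\int_1^2\sum_{|k|\le N}|f_k(\cdot,t)-f_k(\cdot+h,t)|^2\,dt\Big)^{1/2}\Big\|_{L^p(\mathbb{R}^n,w)}<\epsilon .$$ (d) For each $\epsilon>0$ and $N\in\mathbb{N}$ there is $\sigma\in(0,1/2)$ such that for all $\vec f\in\mathcal{G}$, $$\Big\|\sup_{|s|\le\sigma}\Big(\int_{\{t\in[1,2]:\,t+s\in[1,2]\}}\sum_{|k|\le N}|f_k(\cdot,t+s)-f_k(\cdot,t)|^2\,dt\Big)^{1/2}\Big\|_{L^p(\mathbb{R}^n,w)}<\epsilon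 .$$ (e) For each $D>0$ and $\epsilon>0$ there is $N\in\mathbb{N}$ such that for all $\vec f\in\mathcal{G}$, $$\Big\|\Big(\int_1^2\sum_{|k|>N}|f_k(\cdot,t)|^2\,dt\Big)^{1/2}\chi_{B(0,D)}\Big\|_{L^p(\mathbb{R}^n,w)}<\epsilon .$$ Then $\mathcal{G}$ is strongly pre-compact in $L^p(L^2([1,2]),\ell^2;\mathbb{R}^n,w)$, i.e. its closure in the norm topology is compact. -/

import Mathlib

open MeasureTheory Set
open scoped ENNReal

/-- The cube in `ℝⁿ` with centre `c`, side length `2 * r` and sides parallel to the axes. -/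
def axisCube {n : ℕ} (c : EuclideanSpace ℝ (Fin n)) (r : ℝ) : Set (EuclideanSpace ℝ (Fin n)) :=
  {x | ∀ i, |x i - c i| ≤ r}

/-- The Muckenhoupt class `A_p(ℝⁿ)` for `1 < p < ∞`: locally integrable functions `w`, positive
almost everywhere, such that
`sup_Q (1/|Q| ∫_Q w) (1/|Q| ∫_Q w ^ (-1/(p-1))) ^ (p-1) < ∞`, where `Q` runs over all cubes. -/
structure IsMuckenhouptWeight {n : ℕ} (p : ℝ) (w : EuclideanSpace ℝ (Fin n) → ℝ) : Prop where
  locallyIntegrable : LocallyIntegrable w volume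
  pos : ∀ᵐ x, 0 < w x
  exists_bound : ∃ C : ℝ, ∀ (c : EuclideanSpace ℝ (Fin n)) (r : ℝ), 0 < r →
    (⨍⁻ x in axisCube c r, ENNReal.ofReal (w x) ∂volume) *
      (⨍⁻ x in axisCube c r, ENNReal.ofReal (w x ^ (-1 / (p - 1))) ∂volume) ^ (p - 1) ≤
        ENNReal.ofReal C

/-- The norm of `L^p(ℝⁿ, w)`, that is `(∫ F(x)^p w(x) dx)^(1/p)`, of a function with values in
`[0, ∞]`. -/
noncomputable def weightedNorm {n : ℕ} (p : ℝ) (w : EuclideanSpace ℝ (Fin n) → ℝ)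
    (F : EuclideanSpace ℝ (Fin n) → ℝ≥0∞) : ℝ≥0∞ :=
  (∫⁻ x, F x ^ p ∂(volume.withDensity fun x => ENNReal.ofReal (w x))) ^ (1 / p)

/-- `‖(∫_1^2 ∑_k |f_k(·,t)|² dt)^(1/2)‖_{L^p(ℝⁿ, w)}` for a sequence of functions `f_k(x, t)`. -/
noncomputable def mixedNorm {n : ℕ} (p : ℝ) (w : EuclideanSpace ℝ (Fin n) → ℝ)
    (f : ℤ → EuclideanSpace ℝ (Fin n) → ℝ → ℂ) : ℝ≥0∞ :=
  weightedNorm p w fun x => (∫⁻ t in Icc (1 : ℝ) 2, ∑' k : ℤ, ‖f k x t‖ₑ ^ 2) ^ (1 / 2 : ℝ)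

/-- Joint (Lebesgue) measurability of every `f_k` on `ℝⁿ × [1, 2]`. -/
def SeqMeasurable {n : ℕ} (f : ℤ → EuclideanSpace ℝ (Fin n) → ℝ → ℂ) : Prop :=
  ∀ k, AEStronglyMeasurable (Function.uncurry (f k))
    ((volume : Measure (EuclideanSpace ℝ (Fin n))).prod (volume.restrict (Icc (1 : ℝ) 2)))

section MixedNormFacts

variable {n : ℕ} {p : ℝ} {w : EuclideanSpace ℝ (Fin n) → ℝ}
  {f g : ℤ → EuclideanSpace ℝ (Fin n) → ℝ → ℂ}

theorem SeqMeasurable.aemeasurable_tsum (hf : SeqMeasurable f) :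
    AEMeasurable (fun z : EuclideanSpace ℝ (Fin n) × ℝ => ∑' k : ℤ, ‖f k z.1 z.2‖ₑ ^ 2)
      ((volume : Measure (EuclideanSpace ℝ (Fin n))).prod (volume.restrict (Icc (1 : ℝ) 2))) :=
  AEMeasurable.tsum fun k => (hf k).enorm.pow_const 2

theorem SeqMeasurable.aemeasurable_inner (hf : SeqMeasurable f) :
    AEMeasurable (fun x : EuclideanSpace ℝ (Fin n) =>
      (∫⁻ t in Icc (1 : ℝ) 2, ∑' k : ℤ, ‖f k x t‖ₑ ^ 2) ^ (1 / 2 : ℝ)) volume :=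
  (hf.aemeasurable_tsum.lintegral_prod_right').pow_const _

theorem l2_enorm_add_le (a b : ℤ → ℂ) :
    (∑' k, ‖a k + b k‖ₑ ^ 2) ^ (1 / 2 : ℝ) ≤
      (∑' k, ‖a k‖ₑ ^ 2) ^ (1 / 2 : ℝ) + (∑' k, ‖b k‖ₑ ^ 2) ^ (1 / 2 : ℝ) := by
  have h := ENNReal.lintegral_Lp_add_le (μ := (Measure.count : Measure ℤ)) (p := 2)
    (f := fun k => ‖a k‖ₑ) (g := fun k => ‖b k‖ₑ)
    (measurable_of_countable _).aemeasurable (measurable_of_countable _).aemeasurable (by norm_num)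
  simp only [lintegral_count, Pi.add_apply, ENNReal.rpow_two] at h
  refine le_trans ?_ h
  gcongr with k
  exact enorm_add_le _ _

theorem mixedNorm_add_le (hp : 1 ≤ p) (hf : SeqMeasurable f) (hg : SeqMeasurable g) :
    mixedNorm p w (f + g) ≤ mixedNorm p w f + mixedNorm p w g := by
  have hac := withDensity_absolutelyContinuous (volume : Measure (EuclideanSpace ℝ (Fin n)))
    (fun x => ENNReal.ofReal (w x))
  refine le_trans ?_ (ENNReal.lintegral_Lp_add_le (hf.aemeasurable_inner.mono_ac hac)
    (hg.aemeasurable_inner.mono_ac hac) hp)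
  unfold mixedNorm weightedNorm
  refine ENNReal.rpow_le_rpow (lintegral_mono_ae (hac.ae_le ?_)) (by positivity)
  filter_upwards [hf.aemeasurable_tsum.aestronglyMeasurable.prodMk_left,
    hg.aemeasurable_tsum.aestronglyMeasurable.prodMk_left] with x hfx hgx
  refine ENNReal.rpow_le_rpow ?_ (by positivity)
  have h := ENNReal.lintegral_Lp_add_le (μ := volume.restrict (Icc (1 : ℝ) 2)) (p := 2)
    (hfx.aemeasurable.pow_const (1 / 2 : ℝ)) (hgx.aemeasurable.pow_const (1 / 2 : ℝ)) (by norm_num)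
  have hsq : ∀ a : ℝ≥0∞, (a ^ (1 / 2 : ℝ)) ^ (2 : ℝ) = a := fun a => by
    rw [← ENNReal.rpow_mul]; norm_num
  simp only [Pi.add_apply, hsq] at h
  refine le_trans (ENNReal.rpow_le_rpow (lintegral_mono fun t => ?_) (by positivity)) h
  have h2 := ENNReal.rpow_le_rpow (z := 2)
    (l2_enorm_add_le (fun k => f k x t) fun k => g k x t) (by norm_num)
  rwa [hsq] at h2

theorem mixedNorm_const_smul (hp : 1 ≤ p) (c : ℂ) (f : ℤ → EuclideanSpace ℝ (Fin n) → ℝ → ℂ) :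
    mixedNorm p w (c • f) = ‖c‖ₑ * mixedNorm p w f := by
  have hp0 : 0 < p := by linarith
  unfold mixedNorm weightedNorm
  simp only [Pi.smul_apply, enorm_smul, mul_pow, ENNReal.tsum_mul_left]
  have hc : ‖c‖ₑ ≠ ∞ := enorm_ne_top
  have h1 : ∀ x : EuclideanSpace ℝ (Fin n),
      ((∫⁻ t in Icc (1 : ℝ) 2, ‖c‖ₑ ^ 2 * ∑' k : ℤ, ‖f k x t‖ₑ ^ 2) ^ (1 / 2 : ℝ)) ^ p =
      ‖c‖ₑ ^ p * ((∫⁻ t in Icc (1 : ℝ) 2, ∑' k : ℤ, ‖f k x t‖ₑ ^ 2) ^ (1 / 2 : ℝ)) ^ p := by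
    intro x
    rw [lintegral_const_mul' _ _ (ENNReal.pow_ne_top hc),
      ENNReal.mul_rpow_of_nonneg _ _ (by norm_num), ENNReal.mul_rpow_of_nonneg _ _ hp0.le,
      ← ENNReal.rpow_two, ← ENNReal.rpow_mul ‖c‖ₑ]
    norm_num
  simp only [h1]
  rw [lintegral_const_mul' _ _ (ENNReal.rpow_ne_top_of_nonneg hp0.le hc),
    ENNReal.mul_rpow_of_nonneg _ _ (by positivity), ← ENNReal.rpow_mul,
    mul_one_div_cancel hp0.ne', ENNReal.rpow_one]

theorem mixedNorm_zero (hp : 1 ≤ p) :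
    mixedNorm p w (0 : ℤ → EuclideanSpace ℝ (Fin n) → ℝ → ℂ) = 0 := by
  simpa using mixedNorm_const_smul (w := w) hp 0 (0 : ℤ → EuclideanSpace ℝ (Fin n) → ℝ → ℂ)

end MixedNormFacts

/-- The vector space of all sequences `{f_k}_{k ∈ ℤ}` of measurable functions on `ℝⁿ × [1, 2]` (the
values `f k x t` with `t ∉ [1, 2]` play no role) with
`‖(∫_1^2 ∑_k |f_k(·,t)|² dt)^(1/2)‖_{L^p(ℝⁿ, w)} < ∞`; functions that agree almost everywhere are
not yet identified. -/
def mixedSubmodule {n : ℕ} (p : ℝ) [hp : Fact (1 ≤ p)] (w : EuclideanSpace ℝ (Fin n) → ℝ) :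
    Submodule ℂ (ℤ → EuclideanSpace ℝ (Fin n) → ℝ → ℂ) where
  carrier := {f | SeqMeasurable f ∧ mixedNorm p w f < ∞}
  zero_mem' := ⟨fun _ => aestronglyMeasurable_const, by rw [mixedNorm_zero hp.out]; simp⟩
  add_mem' := fun hf hg => ⟨fun k => (hf.1 k).add (hg.1 k),
    (mixedNorm_add_le hp.out hf.1 hg.1).trans_lt (ENNReal.add_lt_top.2 ⟨hf.2, hg.2⟩)⟩
  smul_mem' := fun c f hf => ⟨fun k => (hf.1 k).const_smul c, by
    rw [mixedNorm_const_smul hp.out]; exact ENNReal.mul_lt_top enorm_lt_top hf.2⟩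

/-- `mixedSubmodule p w` as a seminormed space of its own (a type synonym, so that it does not
inherit the topology of pointwise convergence). -/
def MixedFun {n : ℕ} (p : ℝ) [Fact (1 ≤ p)] (w : EuclideanSpace ℝ (Fin n) → ℝ) : Type :=
  ↥(mixedSubmodule p w)

namespace MixedFun

variable {n : ℕ} {p : ℝ} [hp : Fact (1 ≤ p)] {w : EuclideanSpace ℝ (Fin n) → ℝ}

instance : AddCommGroup (MixedFun p w) := inferInstanceAs (AddCommGroup ↥(mixedSubmodule p w))

noncomputable instance : Module ℂ (MixedFun p w) :=
  inferInstanceAs (Module ℂ ↥(mixedSubmodule p w))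

/-- The sequence of functions `f_k(x, t)` underlying an element. -/
def toFun (f : MixedFun p w) : ℤ → EuclideanSpace ℝ (Fin n) → ℝ → ℂ := f.1

instance : CoeFun (MixedFun p w) fun _ => ℤ → EuclideanSpace ℝ (Fin n) → ℝ → ℂ := ⟨toFun⟩

/-- The mixed norm as a seminorm. -/
noncomputable def mixedSeminorm (p : ℝ) [hp : Fact (1 ≤ p)] (w : EuclideanSpace ℝ (Fin n) → ℝ) :
    Seminorm ℂ (MixedFun p w) :=
  Seminorm.of (fun f => (mixedNorm p w f).toReal)
    (fun f g =>
      (ENNReal.toReal_mono (ENNReal.add_ne_top.2 ⟨f.2.2.ne, g.2.2.ne⟩)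
        (mixedNorm_add_le hp.out f.2.1 g.2.1)).trans
          (ENNReal.toReal_add f.2.2.ne g.2.2.ne).le)
    (fun c f => by
      have h := congrArg ENNReal.toReal (mixedNorm_const_smul (w := w) hp.out c f.1)
      rwa [ENNReal.toReal_mul, toReal_enorm] at h)

noncomputable instance : SeminormedAddCommGroup (MixedFun p w) :=
  (mixedSeminorm p w).toAddGroupSeminorm.toSeminormedAddCommGroup

theorem norm_def (f : MixedFun p w) : ‖f‖ = (mixedNorm p w f).toReal := rfl

noncomputable instance : NormedSpace ℂ (MixedFun p w) where
  norm_smul_le c f := (map_smul_eq_mul (mixedSeminorm p w) c f).le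

end MixedFun

/-- The normed space `L^p(L²([1,2]), ℓ²; ℝⁿ, w)`: sequences of functions with finite mixed norm, two
of them being identified when their difference has norm zero. -/
abbrev MixedSpace {n : ℕ} (p : ℝ) [Fact (1 ≤ p)] (w : EuclideanSpace ℝ (Fin n) → ℝ) : Type :=
  SeparationQuotient (MixedFun p w)

/-! ### Completeness of the mixed-norm space. -/

section Completeness

variable {n : ℕ} {p : ℝ} {w : EuclideanSpace ℝ (Fin n) → ℝ}

/-! The space is complete (a Riesz–Fischer argument), so it suffices that the image of `G` is
totally bounded. A bounded set is totally bounded once, for each ε, it lies within ε of some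
finite-dimensional subspace (`totallyBounded_of_finiteDimensional_approx`).

The subspace consists of step functions: constant in x on finitely many pieces of diameter at most ρ
of the ball ‖x‖ ≤ A, constant in t on cells of length 1/M, and zero for |k| > N or ‖x‖ > A. A given
f is moved into it in three stages. Cutting off costs what (b) and (e) control
(`mixedNorm_sub_cutoff_le`). Averaging in t over the cells costs at most twice the modulus in (d),
since an average over a cell compares f(x,t) only with f(x,t+s), |s| ≤ 1/M
(`lintegral_sub_cellAvg_le`). Finally the slice at x is replaced by the slice at one chosen point of
the piece containing x. No averaging in x is needed: the supremum over h in (c) stands inside the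
norm, so it bounds the difference from any chosen point with an integrable slice, for almost every x
(`exists_mixedNorm_timeAvg_sub_stepFun_le`). -/

theorem tsum_iSup_of_monotone {ι : Type*} [Countable ι] {H : ℕ → ι → ℝ≥0∞} (hH : Monotone H) :
    ∑' k, ⨆ m, H m k = ⨆ m, ∑' k, H m k := by
  let _ : MeasurableSpace ι := ⊤
  have h := lintegral_iSup (μ := (Measure.count : Measure ι)) (f := H)
    (fun m => measurable_of_countable _) hH
  simpa only [lintegral_count] using h

theorem ENNReal.iSup_rpow {ι : Sort*} (F : ι → ℝ≥0∞) {r : ℝ} (hr : 0 < r) :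
    (⨆ m, F m) ^ r = ⨆ m, F m ^ r :=
  (ENNReal.orderIsoRpow r hr).map_iSup F

theorem ENNReal.iSup_sq {ι : Sort*} (F : ι → ℝ≥0∞) : (⨆ m, F m) ^ 2 = ⨆ m, F m ^ 2 := by
  simp only [← ENNReal.rpow_two]
  exact ENNReal.iSup_rpow F (by norm_num)

theorem weightedNorm_mono_ae (hp : 0 < p) {F H : EuclideanSpace ℝ (Fin n) → ℝ≥0∞}
    (h : ∀ᵐ x, F x ≤ H x) : weightedNorm p w F ≤ weightedNorm p w H := by
  have hac := withDensity_absolutelyContinuous (volume : Measure (EuclideanSpace ℝ (Fin n)))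
    (fun x => ENNReal.ofReal (w x))
  refine ENNReal.rpow_le_rpow (lintegral_mono_ae (hac.ae_le ?_)) (by positivity)
  filter_upwards [h] with x hx
  exact ENNReal.rpow_le_rpow hx hp.le

theorem weightedNorm_iSup (hp : 0 < p) {F : ℕ → EuclideanSpace ℝ (Fin n) → ℝ≥0∞}
    (hF : ∀ m, AEMeasurable (F m) volume) (hmono : ∀ᵐ x, Monotone fun m => F m x) :
    weightedNorm p w (fun x => ⨆ m, F m x) = ⨆ m, weightedNorm p w (F m) := by
  have hac := withDensity_absolutelyContinuous (volume : Measure (EuclideanSpace ℝ (Fin n)))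
    (fun x => ENNReal.ofReal (w x))
  unfold weightedNorm
  simp only [ENNReal.iSup_rpow _ hp]
  rw [lintegral_iSup' (fun m => ((hF m).mono_ac hac).pow_const p), ENNReal.iSup_rpow]
  · positivity
  · filter_upwards [hac.ae_le hmono] with x hx a b hab
    exact ENNReal.rpow_le_rpow (hx hab) hp.le

/-- Countable subadditivity of the mixed norm. -/
theorem weightedNorm_tsum_le (hp : 1 ≤ p) {f : ℕ → ℤ → EuclideanSpace ℝ (Fin n) → ℝ → ℂ}
    (hf : ∀ j, SeqMeasurable (f j)) :
    weightedNorm p w (fun x => (∫⁻ t in Icc (1 : ℝ) 2,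
      ∑' k : ℤ, (∑' j, ‖f j k x t‖ₑ) ^ 2) ^ (1 / 2 : ℝ)) ≤ ∑' j, mixedNorm p w (f j) := by
  have hp0 : 0 < p := by linarith
  -- Absolute values make the partial sums increase in modulus, so the finite triangle inequality
  -- passes to the limit by monotone convergence in k, t and x successively.
  let g : ℕ → ℤ → EuclideanSpace ℝ (Fin n) → ℝ → ℂ := fun j k x t => (‖f j k x t‖ : ℂ)
  have hg : ∀ j, SeqMeasurable (g j) := fun j k =>
    Complex.continuous_ofReal.comp_aestronglyMeasurable (hf j k).norm
  let S : ℕ → ℤ → EuclideanSpace ℝ (Fin n) → ℝ → ℂ := fun m => ∑ j ∈ Finset.range m, g j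
  have hS : ∀ m, SeqMeasurable (S m) ∧ mixedNorm p w (S m) ≤ ∑' j, mixedNorm p w (f j) := by
    have key : ∀ m, SeqMeasurable (S m) ∧
        mixedNorm p w (S m) ≤ ∑ j ∈ Finset.range m, mixedNorm p w (f j) := by
      intro m
      induction m with
      | zero =>
        refine ⟨fun k => ?_, ?_⟩
        · simp only [S, Finset.range_zero, Finset.sum_empty]
          exact aestronglyMeasurable_const
        · simp only [S, Finset.range_zero, Finset.sum_empty]
          rw [mixedNorm_zero hp]
      | succ m ih =>
        have hgm : mixedNorm p w (g m) = mixedNorm p w (f m) := by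
          have hk : ∀ k x t, ‖g m k x t‖ₑ = ‖f m k x t‖ₑ := fun k x t => by
            rw [← ofReal_norm, ← ofReal_norm, Complex.norm_real, norm_norm]
          simp only [mixedNorm, hk]
        have h1 : S (m + 1) = S m + g m := Finset.sum_range_succ _ _
        rw [h1, Finset.sum_range_succ]
        exact ⟨fun k => (ih.1 k).add (hg m k),
          (mixedNorm_add_le hp ih.1 (hg m)).trans (add_le_add ih.2 hgm.le)⟩
    exact fun m => ⟨(key m).1, (key m).2.trans (ENNReal.sum_le_tsum _)⟩
  have hval : ∀ m k x t, ‖S m k x t‖ₑ = ∑ j ∈ Finset.range m, ‖f j k x t‖ₑ := by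
    intro m k x t
    have h1 : S m k x t = ((∑ j ∈ Finset.range m, ‖f j k x t‖ : ℝ) : ℂ) := by
      simp only [S, g, Finset.sum_apply, Complex.ofReal_sum]
    rw [h1, ← ofReal_norm, Complex.norm_real,
      Real.norm_of_nonneg (Finset.sum_nonneg fun _ _ => norm_nonneg _),
      ENNReal.ofReal_sum_of_nonneg fun _ _ => norm_nonneg _]
    simp only [ofReal_norm]
  have hmono : ∀ x t, Monotone fun m => fun k => ‖S m k x t‖ₑ ^ 2 := by
    intro x t a b hab k
    dsimp only
    rw [hval, hval]
    gcongr
  refine le_trans (le_of_eq ?_) (iSup_le fun m => (hS m).2)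
  unfold mixedNorm
  rw [← weightedNorm_iSup hp0 (fun m => (hS m).1.aemeasurable_inner)]
  · refine le_antisymm (weightedNorm_mono_ae hp0 ?_) (weightedNorm_mono_ae hp0 ?_)
    all_goals
      filter_upwards [ae_all_iff.2 fun m =>
        (hS m).1.aemeasurable_tsum.aestronglyMeasurable.prodMk_left] with x hx
      refine le_of_eq ?_
      rw [← ENNReal.iSup_rpow _ (by norm_num), ← lintegral_iSup' (fun m => (hx m).aemeasurable)
        (Filter.Eventually.of_forall fun t a b hab => ENNReal.tsum_le_tsum (hmono x t hab))]
      have hk : ∀ t, ⨆ m, ∑' k, ‖S m k x t‖ₑ ^ 2 = ∑' k, (∑' j, ‖f j k x t‖ₑ) ^ 2 := fun t => by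
        rw [← tsum_iSup_of_monotone (hmono x t)]
        refine tsum_congr fun k => ?_
        rw [← ENNReal.iSup_sq, ENNReal.tsum_eq_iSup_nat]
        simp only [hval]
      simp only [hk]
  · refine Filter.Eventually.of_forall fun x a b hab => ?_
    exact ENNReal.rpow_le_rpow (lintegral_mono fun t =>
      ENNReal.tsum_le_tsum (hmono x t hab)) (by norm_num)

/-- Holds without summability: if the series is not absolutely convergent, the right side is ∞.
Hence no exceptional null set has to be removed when sequences of functions are summed pointwise. -/
theorem enorm_tsum_sub_sum_le (a : ℕ → ℂ) (m : ℕ) :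
    ‖∑' j, a j - ∑ j ∈ Finset.range m, a j‖ₑ ≤ ∑' j, ‖a (j + m)‖ₑ := by
  by_cases h : Summable a
  · rw [← h.sum_add_tsum_nat_add m, add_sub_cancel_left]
    exact enorm_tsum_le_tsum_enorm
  · have h2 : ∑' j, ‖a (j + m)‖ₑ = ∞ := by
      by_contra h3
      exact h ((summable_nat_add_iff m).1 (tsum_enorm_ne_top_iff_summable_norm.1 h3).of_norm)
    simp [h2]

theorem MixedFun.enorm_eq [Fact (1 ≤ p)] (f : MixedFun p w) :
    ENNReal.ofReal ‖f‖ = mixedNorm p w f := by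
  exact ENNReal.ofReal_toReal f.2.2.ne

/-- The limit is the pointwise sum; its distance from the m-th partial sum is at most the tail of
the convergent series of norms, by countable subadditivity. -/
theorem MixedFun.exists_tendsto_sum [hp : Fact (1 ≤ p)] (u : ℕ → MixedFun p w)
    (hu : Summable fun j => ‖u j‖) :
    ∃ a, Filter.Tendsto (fun m => ∑ j ∈ Finset.range m, u j) Filter.atTop (nhds a) := by
  have hsum : ∑' j, mixedNorm p w (u j) ≠ ∞ := by
    simp only [← MixedFun.enorm_eq]
    rw [← ENNReal.ofReal_tsum_of_nonneg (fun _ => norm_nonneg _) hu]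
    exact ENNReal.ofReal_ne_top
  have hm : ∀ j, SeqMeasurable (u j) := fun j => (u j).2.1
  let F : ℤ → EuclideanSpace ℝ (Fin n) → ℝ → ℂ := fun k x t => ∑' j, u j k x t
  have hFm : SeqMeasurable F := fun k =>
    (AEMeasurable.tsum fun j => (hm j k).aemeasurable).aestronglyMeasurable
  have hcoe : ∀ m k x t, (∑ j ∈ Finset.range m, u j : MixedFun p w) k x t =
      ∑ j ∈ Finset.range m, u j k x t := by
    intro m k x t
    have h : (∑ j ∈ Finset.range m, u j : MixedFun p w).toFun =
        ∑ j ∈ Finset.range m, (u j).toFun :=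
      map_sum (mixedSubmodule p w).subtype _ _
    rw [h]
    simp only [Finset.sum_apply]
  have hbound : ∀ m, mixedNorm p w
      (F - (∑ j ∈ Finset.range m, u j : MixedFun p w).toFun) ≤
        ∑' j, mixedNorm p w (u (j + m)) := by
    intro m
    refine le_trans (weightedNorm_mono_ae (by linarith [hp.out])
      (Filter.Eventually.of_forall fun x => ?_)) (weightedNorm_tsum_le hp.out fun j => hm (j + m))
    refine ENNReal.rpow_le_rpow (lintegral_mono fun t => ENNReal.tsum_le_tsum fun k => ?_)
      (by norm_num)
    simp only [Pi.sub_apply, hcoe]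
    gcongr
    exact enorm_tsum_sub_sum_le (fun j => u j k x t) m
  have hFfin : mixedNorm p w F < ∞ := by
    have h := hbound 0
    have h0 : (∑ j ∈ Finset.range 0, u j : MixedFun p w).toFun = 0 := rfl
    rw [h0, sub_zero] at h
    exact h.trans_lt (by simpa using hsum.lt_top)
  refine ⟨⟨F, hFm, hFfin⟩, tendsto_iff_norm_sub_tendsto_zero.2 ?_⟩
  simp only [norm_sub_rev (_ : MixedFun p w) (⟨F, hFm, hFfin⟩ : MixedFun p w)]
  have hlim := ENNReal.tendsto_sum_nat_add (fun j => mixedNorm p w (u j)) hsum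
  have hlim2 : Filter.Tendsto (fun m => mixedNorm p w
      (F - (∑ j ∈ Finset.range m, u j : MixedFun p w).toFun)) Filter.atTop (nhds 0) :=
    tendsto_of_tendsto_of_tendsto_of_le_of_le tendsto_const_nhds hlim (fun _ => zero_le) hbound
  exact (ENNReal.tendsto_toReal ENNReal.zero_ne_top).comp hlim2

theorem MixedSpace.completeSpace [Fact (1 ≤ p)] : CompleteSpace (MixedSpace p w) := by
  refine NormedAddCommGroup.completeSpace_of_summable_imp_tendsto fun u hu => ?_
  choose v hv using fun j => SeparationQuotient.surjective_mk (u j)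
  obtain rfl : (fun j => SeparationQuotient.mk (v j)) = u := funext hv
  simp only [SeparationQuotient.norm_mk] at hu
  obtain ⟨a, ha⟩ := MixedFun.exists_tendsto_sum v hu
  refine ⟨SeparationQuotient.mk a, ?_⟩
  have h := (SeparationQuotient.continuous_mk.tendsto a).comp ha
  refine h.congr fun m => ?_
  exact map_sum (SeparationQuotient.mkCLM ℂ (MixedFun p w)) _ _

end Completeness

/-- Cauchy–Schwarz. -/
theorem lintegral_sq_le {α : Type*} [MeasurableSpace α] {μ : Measure α} {g : α → ℝ≥0∞}
    (hg : AEMeasurable g μ) : (∫⁻ x, g x ∂μ) ^ 2 ≤ μ univ * ∫⁻ x, g x ^ 2 ∂μ := by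
  have h := ENNReal.lintegral_mul_le_Lp_mul_Lq μ Real.HolderConjugate.two_two
    (aemeasurable_const (b := (1 : ℝ≥0∞))) hg
  have hsq : ∀ a : ℝ≥0∞, (a ^ (1 / 2 : ℝ)) ^ 2 = a := fun a => by
    rw [← ENNReal.rpow_natCast, ← ENNReal.rpow_mul]; norm_num
  simp only [Pi.mul_apply, one_mul, ENNReal.rpow_two, one_pow, lintegral_one] at h
  calc (∫⁻ x, g x ∂μ) ^ 2
      ≤ (μ univ ^ (1 / 2 : ℝ) * (∫⁻ x, g x ^ 2 ∂μ) ^ (1 / 2 : ℝ)) ^ 2 := by gcongr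
    _ = _ := by rw [mul_pow, hsq, hsq]

/-- The approximants have norm at most C + ε, hence lie in a closed ball of a finite-dimensional
space, which is compact; a finite ε/2-net of that ball is an ε-net of `B`. -/
theorem totallyBounded_of_finiteDimensional_approx {X : Type*} [NormedAddCommGroup X]
    [NormedSpace ℂ X] {B : Set X} {C : ℝ} (hC : ∀ b ∈ B, ‖b‖ ≤ C)
    (h : ∀ ε : ℝ, 0 < ε → ∃ V : Submodule ℂ X, FiniteDimensional ℂ V ∧
      ∀ b ∈ B, ∃ v ∈ V, ‖b - v‖ < ε) : TotallyBounded B := by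
  rw [Metric.totallyBounded_iff]
  intro ε hε
  obtain ⟨V, hV, hB⟩ := h (ε / 2) (by positivity)
  have := FiniteDimensional.proper ℂ V
  have hK : TotallyBounded ((↑) '' Metric.closedBall (0 : V) (C + ε) : Set X) :=
    ((isCompact_closedBall (0 : V) (C + ε)).image continuous_subtype_val).totallyBounded
  obtain ⟨t, ht, hcov⟩ := Metric.totallyBounded_iff.1 hK (ε / 2) (by positivity)
  refine ⟨t, ht, fun b hb => ?_⟩
  obtain ⟨v, hv, hbv⟩ := hB b hb
  have hvK : v ∈ ((↑) '' Metric.closedBall (0 : V) (C + ε) : Set X) := by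
    refine ⟨⟨v, hv⟩, ?_, rfl⟩
    rw [mem_closedBall_zero_iff, Submodule.coe_norm]
    have h1 : ‖v‖ ≤ ‖b‖ + ‖b - v‖ := by
      simpa using norm_sub_le b (b - v)
    linarith [hC b hb]
  obtain ⟨y, hy, hvy⟩ := mem_iUnion₂.1 (hcov hvK)
  refine mem_iUnion₂.2 ⟨y, hy, ?_⟩
  rw [Metric.mem_ball] at hvy ⊢
  have h2 := dist_triangle b v y
  rw [dist_eq_norm b v] at h2
  linarith

/-! ### Averaging over cells in the t variable. -/

section CellAverages

/-- The points `u ∈ [1, 2]` with `m / M ≤ u < (m + 1) / M`. -/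
def cell (M m : ℕ) : Set ℝ := {u | u ∈ Icc (1 : ℝ) 2 ∧ ⌊(M : ℝ) * u⌋₊ = m}

/-- The average of `g` over `cell M m` (for the cells of full length `1 / M`). -/
noncomputable def cellAvg (M : ℕ) (g : ℝ → ℂ) (m : ℕ) : ℂ := M * ∫ u in cell M m, g u

theorem measurableSet_cell (M m : ℕ) : MeasurableSet (cell M m) :=
  measurableSet_Icc.inter ((Nat.measurable_floor.comp (measurable_const_mul (M : ℝ)))
    (measurableSet_singleton m))

theorem cell_subset (M m : ℕ) : cell M m ⊆ Icc 1 2 := fun _ hu => hu.1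

theorem cell_subset_Ico {M : ℕ} (hM : 0 < M) (m : ℕ) :
    cell M m ⊆ Ico ((m : ℝ) / M) ((m + 1 : ℝ) / M) := by
  rintro u ⟨hu, rfl⟩
  have hM' : (0 : ℝ) < M := by exact_mod_cast hM
  have h0 : 0 ≤ (M : ℝ) * u := mul_nonneg hM'.le (by linarith [hu.1])
  constructor
  · rw [div_le_iff₀ hM', mul_comm u]
    exact Nat.floor_le h0
  · rw [lt_div_iff₀ hM', mul_comm u]
    exact Nat.lt_floor_add_one _

theorem volume_cell_le {M : ℕ} (hM : 0 < M) (m : ℕ) : (M : ℝ≥0∞) * volume (cell M m) ≤ 1 := by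
  have hM' : (0 : ℝ) < M := by exact_mod_cast hM
  calc (M : ℝ≥0∞) * volume (cell M m)
      ≤ M * volume (Ico ((m : ℝ) / M) ((m + 1 : ℝ) / M)) := by
        gcongr
        exact cell_subset_Ico hM m
    _ = ENNReal.ofReal M * ENNReal.ofReal (1 / M) := by
        rw [Real.volume_Ico, ENNReal.ofReal_natCast]
        congr 2
        ring
    _ = 1 := by
        rw [← ENNReal.ofReal_mul hM'.le, mul_one_div_cancel hM'.ne', ENNReal.ofReal_one]

/-- The endpoint t = 2 is excluded because its cell, with index 2M, is the single point 2 and has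
measure zero. -/
theorem volume_real_cell {M : ℕ} (hM : 0 < M) {t : ℝ} (ht : t ∈ Ico (1 : ℝ) 2) :
    (M : ℝ) * volume.real (cell M ⌊(M : ℝ) * t⌋₊) = 1 := by
  have hM' : (0 : ℝ) < M := by exact_mod_cast hM
  have h0 : 0 ≤ (M : ℝ) * t := mul_nonneg hM'.le (by linarith [ht.1])
  set m := ⌊(M : ℝ) * t⌋₊ with hm
  have hm1 : M ≤ m := Nat.le_floor (by nlinarith [ht.1])
  have hm2 : m + 1 ≤ 2 * M := by
    have : m < 2 * M := (Nat.floor_lt h0).2 (by push_cast; nlinarith [ht.2])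
    omega
  have hm1' : (M : ℝ) ≤ m := by exact_mod_cast hm1
  have hm2' : (m : ℝ) + 1 ≤ 2 * M := by exact_mod_cast hm2
  have hcell : cell M m = Ico ((m : ℝ) / M) ((m + 1 : ℝ) / M) := by
    refine (cell_subset_Ico hM m).antisymm fun u hu => ?_
    have h1 : (m : ℝ) ≤ M * u := by rw [mul_comm]; exact (div_le_iff₀ hM').1 hu.1
    have h2 : M * u < (m : ℝ) + 1 := by rw [mul_comm]; exact (lt_div_iff₀ hM').1 hu.2
    refine ⟨⟨?_, ?_⟩, (Nat.floor_eq_iff (le_trans (by positivity) h1)).2 ⟨h1, h2⟩⟩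
    · by_contra! h; nlinarith
    · by_contra! h; nlinarith
  rw [hcell, Measure.real, Real.volume_Ico, ENNReal.toReal_ofReal]
  · field_simp
    ring
  · rw [← sub_div]
    simp only [add_sub_cancel_left]
    positivity

/-- Cauchy–Schwarz on the cell; only M · |cell| ≤ 1 is used, so degenerate cells are covered too. -/
theorem enorm_cellAvg_sq_le {M : ℕ} (hM : 0 < M) {g : ℝ → ℂ} {m : ℕ}
    (hg : AEStronglyMeasurable g (volume.restrict (Icc (1 : ℝ) 2))) :
    ‖cellAvg M g m‖ₑ ^ 2 ≤ M * ∫⁻ u in cell M m, ‖g u‖ₑ ^ 2 := by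
  have hg' := hg.mono_measure (Measure.restrict_mono_set volume (cell_subset M m))
  have hMe : ‖(M : ℂ)‖ₑ = M := by
    rw [← ofReal_norm, Complex.norm_natCast, ENNReal.ofReal_natCast]
  calc ‖cellAvg M g m‖ₑ ^ 2 ≤ (M * ∫⁻ u in cell M m, ‖g u‖ₑ) ^ 2 := by
        rw [cellAvg, enorm_mul, hMe]
        gcongr
        exact enorm_integral_le_lintegral_enorm _
    _ = M ^ 2 * (∫⁻ u in cell M m, ‖g u‖ₑ) ^ 2 := mul_pow _ _ _
    _ ≤ M ^ 2 * (volume (cell M m) * ∫⁻ u in cell M m, ‖g u‖ₑ ^ 2) := by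
        gcongr
        simpa using lintegral_sq_le hg'.enorm
    _ = (M * volume (cell M m)) * (M * ∫⁻ u in cell M m, ‖g u‖ₑ ^ 2) := by ring
    _ ≤ 1 * (M * ∫⁻ u in cell M m, ‖g u‖ₑ ^ 2) := by gcongr; exact volume_cell_le hM m
    _ = _ := one_mul _

theorem floor_le_of_mem {M : ℕ} {t : ℝ} (ht : t ∈ Icc (1 : ℝ) 2) :
    ⌊(M : ℝ) * t⌋₊ ≤ 2 * M := by
  refine Nat.floor_le_of_le ?_
  push_cast
  nlinarith [ht.2, (Nat.cast_nonneg M : (0 : ℝ) ≤ M)]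

theorem lintegral_eq_sum_cell (M : ℕ) (φ : ℝ → ℝ≥0∞) :
    ∫⁻ t in Icc (1 : ℝ) 2, φ t = ∑ m ∈ Finset.range (2 * M + 1), ∫⁻ t in cell M m, φ t := by
  have h : Icc (1 : ℝ) 2 = ⋃ m ∈ Finset.range (2 * M + 1), cell M m := by
    ext t
    simp only [mem_iUnion, Finset.mem_range, exists_prop]
    refine ⟨fun ht => ⟨_, Nat.lt_succ_of_le (floor_le_of_mem ht), ht, rfl⟩, ?_⟩
    rintro ⟨m, -, ht⟩
    exact ht.1
  rw [h, lintegral_biUnion_finset (fun i _ j _ hij => ?_) fun m _ => measurableSet_cell M m]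
  exact disjoint_left.2 fun t hi hj => hij (hi.2.symm.trans hj.2)

theorem lintegral_cellAvg_le {M : ℕ} (hM : 0 < M) {g : ℝ → ℂ}
    (hg : AEStronglyMeasurable g (volume.restrict (Icc (1 : ℝ) 2))) :
    ∫⁻ t in Icc (1 : ℝ) 2, ‖cellAvg M g ⌊(M : ℝ) * t⌋₊‖ₑ ^ 2 ≤
      ∫⁻ t in Icc (1 : ℝ) 2, ‖g t‖ₑ ^ 2 := by
  rw [lintegral_eq_sum_cell M, lintegral_eq_sum_cell M]
  refine Finset.sum_le_sum fun m _ => ?_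
  have h : ∫⁻ t in cell M m, ‖cellAvg M g ⌊(M : ℝ) * t⌋₊‖ₑ ^ 2 =
      ∫⁻ _ in cell M m, ‖cellAvg M g m‖ₑ ^ 2 :=
    setLIntegral_congr_fun (measurableSet_cell M m) fun t ht => by simp only [ht.2]
  rw [h, setLIntegral_const]
  calc ‖cellAvg M g m‖ₑ ^ 2 * volume (cell M m)
      ≤ (M * ∫⁻ u in cell M m, ‖g u‖ₑ ^ 2) * volume (cell M m) := by
        gcongr
        exact enorm_cellAvg_sq_le hM hg
    _ = (M * volume (cell M m)) * ∫⁻ u in cell M m, ‖g u‖ₑ ^ 2 := by ring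
    _ ≤ 1 * ∫⁻ u in cell M m, ‖g u‖ₑ ^ 2 := by gcongr; exact volume_cell_le hM m
    _ = _ := one_mul _

theorem sub_cellAvg {M : ℕ} (hM : 0 < M) {g : ℝ → ℂ} (hg : IntegrableOn g (Icc 1 2))
    {t : ℝ} (ht : t ∈ Ico (1 : ℝ) 2) :
    g t - cellAvg M g ⌊(M : ℝ) * t⌋₊ = cellAvg M (fun u => g t - g u) ⌊(M : ℝ) * t⌋₊ := by
  have hfin : volume (cell M ⌊(M : ℝ) * t⌋₊) ≠ ∞ :=
    ((measure_mono (cell_subset M _)).trans_lt (by simp)).ne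
  have h := volume_real_cell hM ht
  simp only [cellAvg]
  have hc : Integrable (fun _ => g t) (volume.restrict (cell M ⌊(M : ℝ) * t⌋₊)) :=
    integrableOn_const hfin
  rw [integral_sub hc (hg.mono_set (cell_subset M _)),
    setIntegral_const, mul_sub, Complex.real_smul, ← mul_assoc]
  have h' : (M : ℂ) * (volume.real (cell M ⌊(M : ℝ) * t⌋₊) : ℂ) = 1 := by exact_mod_cast h
  rw [h', one_mul]

/-- Averaging over cells of length `1 / M` is controlled by translations by at most `1 / M`. -/
theorem lintegral_sub_cellAvg_le {M : ℕ} (hM : 0 < M) (K : Finset ℤ) {a : ℤ → ℝ → ℂ}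
    (ha : ∀ k, IntegrableOn (a k) (Icc 1 2)) {S : ℝ≥0∞}
    (hS : ∀ s : ℝ, |s| ≤ 1 / M →
      ∫⁻ t in {t : ℝ | t ∈ Icc (1 : ℝ) 2 ∧ t + s ∈ Icc (1 : ℝ) 2},
        ∑ k ∈ K, ‖a k (t + s) - a k t‖ₑ ^ 2 ≤ S) :
    ∫⁻ t in Icc (1 : ℝ) 2, ∑ k ∈ K, ‖a k t - cellAvg M (a k) ⌊(M : ℝ) * t⌋₊‖ₑ ^ 2 ≤ 2 * S := by
  have hM' : (0 : ℝ) < M := by exact_mod_cast hM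
  let E : Set (ℝ × ℝ) :=
    {z | (z.1 ∈ Icc (1 : ℝ) 2 ∧ z.1 + z.2 ∈ Icc (1 : ℝ) 2) ∧ |z.2| ≤ 1 / M}
  have hE : MeasurableSet E :=
    ((measurable_fst measurableSet_Icc).inter
      ((measurable_fst.add measurable_snd) measurableSet_Icc)).inter
        (measurableSet_le measurable_snd.abs measurable_const)
  let F : ℝ × ℝ → ℝ≥0∞ := E.indicator fun z => ∑ k ∈ K, ‖a k (z.1 + z.2) - a k z.1‖ₑ ^ 2
  -- `a k` is measurable only on [1, 2]; on `E` both arguments lie there, so the extension by zero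
  -- may replace it. Measurability of its translate follows because (t, s) ↦ (t, t + s) preserves
  -- measure.
  let b : ℤ → ℝ → ℂ := fun k => (Icc (1 : ℝ) 2).indicator (a k)
  have hb : ∀ k, AEStronglyMeasurable (b k) volume := fun k =>
    (aestronglyMeasurable_indicator_iff measurableSet_Icc).2 (ha k).aestronglyMeasurable
  have hF : AEMeasurable F (volume.prod volume) := by
    have h1 : F = E.indicator fun z => ∑ k ∈ K, ‖b k (z.1 + z.2) - b k z.1‖ₑ ^ 2 := by
      refine indicator_congr fun z hz => ?_
      simp only [b, indicator_of_mem hz.1.1, indicator_of_mem hz.1.2]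
    rw [h1]
    refine AEMeasurable.indicator ?_ hE
    refine Finset.aemeasurable_fun_sum _ fun k _ => (AEStronglyMeasurable.enorm ?_).pow_const 2
    have h2 : AEStronglyMeasurable (fun z : ℝ × ℝ => b k z.2) (volume.prod volume) :=
      (hb k).comp_snd
    exact (h2.comp_measurePreserving (measurePreserving_prod_add volume volume)).sub
      (hb k).comp_fst
  have hstep : ∀ t ∈ Ico (1 : ℝ) 2,
      ∑ k ∈ K, ‖a k t - cellAvg M (a k) ⌊(M : ℝ) * t⌋₊‖ₑ ^ 2 ≤ M * ∫⁻ s, F (t, s) := by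
    intro t ht
    set m := ⌊(M : ℝ) * t⌋₊ with hm
    have hmeas : ∀ k, AEStronglyMeasurable (fun u => a k t - a k u)
        (volume.restrict (Icc (1 : ℝ) 2)) := fun k =>
      aestronglyMeasurable_const.sub (ha k).aestronglyMeasurable
    calc ∑ k ∈ K, ‖a k t - cellAvg M (a k) m‖ₑ ^ 2
        ≤ ∑ k ∈ K, M * ∫⁻ u in cell M m, ‖a k t - a k u‖ₑ ^ 2 := by
          refine Finset.sum_le_sum fun k _ => ?_
          rw [hm, sub_cellAvg hM (ha k) ht]
          exact enorm_cellAvg_sq_le hM (hmeas k)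
      _ = M * ∫⁻ u in cell M m, ∑ k ∈ K, ‖a k t - a k u‖ₑ ^ 2 := by
          rw [← Finset.mul_sum, lintegral_finsetSum' _ fun k _ => ?_]
          exact (((hmeas k).mono_measure
            (Measure.restrict_mono_set volume (cell_subset M m))).enorm).pow_const 2
      -- With s = u - t: two points of one cell differ by at most 1/M, so (t, s) lies in `E`.
      _ ≤ M * ∫⁻ u, F (t, -t + u) := by
          refine mul_le_mul' le_rfl ?_
          rw [← lintegral_indicator (measurableSet_cell M m)]
          refine lintegral_mono fun u => indicator_apply_le' (fun hu => ?_) fun _ => zero_le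
          have h1 := cell_subset_Ico hM m hu
          have h2 := cell_subset_Ico hM m (⟨Ico_subset_Icc_self ht, hm.symm⟩ : t ∈ cell M m)
          have h3 : (t, -t + u) ∈ E := by
            refine ⟨⟨Ico_subset_Icc_self ht, by simpa using hu.1⟩, ?_⟩
            have h4 : ((m : ℝ) + 1) / M = m / M + 1 / M := add_div _ _ _
            rw [abs_le]
            constructor <;> linarith [h1.1, h1.2, h2.1, h2.2]
          simp only [F, indicator_of_mem h3]
          refine Finset.sum_le_sum fun k _ => ?_
          rw [add_neg_cancel_left, enorm_sub_rev]
      _ = M * ∫⁻ s, F (t, s) := by rw [lintegral_add_left_eq_self (fun s => F (t, s)) (-t)]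
  calc ∫⁻ t in Icc (1 : ℝ) 2, ∑ k ∈ K, ‖a k t - cellAvg M (a k) ⌊(M : ℝ) * t⌋₊‖ₑ ^ 2
      = ∫⁻ t in Ico (1 : ℝ) 2, ∑ k ∈ K, ‖a k t - cellAvg M (a k) ⌊(M : ℝ) * t⌋₊‖ₑ ^ 2 := by
        rw [Measure.restrict_congr_set Ico_ae_eq_Icc]
    _ ≤ ∫⁻ t in Ico (1 : ℝ) 2, M * ∫⁻ s, F (t, s) :=
        setLIntegral_mono' measurableSet_Ico hstep
    _ ≤ ∫⁻ t, M * ∫⁻ s, F (t, s) := setLIntegral_le_lintegral _ _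
    _ = M * ∫⁻ s, ∫⁻ t, F (t, s) := by
        rw [lintegral_const_mul' _ _ (ENNReal.natCast_ne_top M),
          lintegral_lintegral_swap (f := fun t s => F (t, s)) hF]
    -- The interval of shifts has length 2/M; this is the source of the factor 2.
    _ ≤ M * ∫⁻ s, (Icc (-(1 / M : ℝ)) (1 / M)).indicator (fun _ => S) s := by
        gcongr with s
        by_cases hs : |s| ≤ 1 / M
        · rw [indicator_of_mem (mem_Icc.2 (abs_le.1 hs))]
          refine le_trans (le_of_eq ?_) (hS s hs)
          rw [← lintegral_indicator]
          · refine lintegral_congr fun t => ?_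
            simp only [F, E, indicator, mem_ofPred_eq, hs, and_true]
          · exact measurableSet_Icc.inter ((measurable_add_const s) measurableSet_Icc)
        · have h0 : ∀ t, F (t, s) = 0 := fun t => indicator_of_notMem (fun h => hs h.2) _
          simp [h0]
    _ = 2 * S := by
        rw [lintegral_indicator_const measurableSet_Icc, Real.volume_Icc,
          ← ENNReal.ofReal_natCast, mul_left_comm, ← ENNReal.ofReal_mul hM'.le]
        have h2 : (M : ℝ) * (1 / M - -(1 / M)) = 2 := by field_simp; norm_num
        rw [h2, mul_comm]
        norm_num

end CellAverages

/-! ### Partition of a ball, cutoffs, step functions and time averages. -/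

section StepApproximation

variable {n : ℕ} {p : ℝ} {w : EuclideanSpace ℝ (Fin n) → ℝ}

/-- The label is the index of the nearest among finitely many points of a dense sequence, enough of
them that every point of the ball is within ρ/2 of one; nearest-point labels are measurable. -/
theorem exists_finite_label (A : ℝ) {ρ : ℝ} (hρ : 0 < ρ) :
    ∃ (R : ℕ) (π : EuclideanSpace ℝ (Fin n) → Fin (R + 1)), Measurable π ∧
      ∀ x y, ‖x‖ ≤ A → ‖y‖ ≤ A → π x = π y → ‖y - x‖ ≤ ρ := by
  obtain ⟨e, he⟩ := TopologicalSpace.exists_dense_seq (EuclideanSpace ℝ (Fin n))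
  have hcov : Metric.closedBall (0 : EuclideanSpace ℝ (Fin n)) A ⊆
      ⋃ i, Metric.ball (e i) (ρ / 2) := fun x _ => by
    obtain ⟨i, hi⟩ := he.exists_dist_lt x (half_pos hρ)
    exact mem_iUnion.2 ⟨i, hi⟩
  obtain ⟨s, hs⟩ := (isCompact_closedBall (0 : EuclideanSpace ℝ (Fin n)) A).elim_finite_subcover
    _ (fun _ => Metric.isOpen_ball) hcov
  let R := s.sup id
  refine ⟨R, fun x => Fin.ofNat (R + 1) (SimpleFunc.nearestPtInd e R x),
    (measurable_of_countable (Fin.ofNat (R + 1))).comp (SimpleFunc.nearestPtInd e R).measurable, ?_⟩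
  have hnear : ∀ x, ‖x‖ ≤ A → dist (e (SimpleFunc.nearestPtInd e R x)) x < ρ / 2 := by
    intro x hx
    obtain ⟨i, his, hi⟩ := mem_iUnion₂.1 (hs (mem_closedBall_zero_iff.2 hx))
    have h := SimpleFunc.edist_nearestPt_le e x (Finset.le_sup (f := id) his)
    rw [edist_dist, edist_dist, ENNReal.ofReal_le_ofReal_iff dist_nonneg] at h
    rw [Metric.mem_ball, dist_comm] at hi
    exact h.trans_lt hi
  intro x y hx hy hxy
  have hxy' : SimpleFunc.nearestPtInd e R x = SimpleFunc.nearestPtInd e R y := by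
    have h := congrArg Fin.val hxy
    simpa [Fin.ofNat, Nat.mod_eq_of_lt (Nat.lt_succ_of_le (SimpleFunc.nearestPtInd_le e R x)),
      Nat.mod_eq_of_lt (Nat.lt_succ_of_le (SimpleFunc.nearestPtInd_le e R y))] using h
  have h1 := hnear x hx
  have h2 := hnear y hy
  rw [← hxy', dist_comm] at h2
  rw [← dist_eq_norm]
  linarith [dist_triangle y (e (SimpleFunc.nearestPtInd e R x)) x]

/-- Restriction of a sequence of functions to `‖x‖ ≤ A` and `|k| ≤ N`. -/
noncomputable def cutoff (A : ℝ) (N : ℕ) (f : ℤ → EuclideanSpace ℝ (Fin n) → ℝ → ℂ) :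
    ℤ → EuclideanSpace ℝ (Fin n) → ℝ → ℂ :=
  fun k x t => if k ∈ Finset.Icc (-(N : ℤ)) N ∧ ‖x‖ ≤ A then f k x t else 0

theorem SeqMeasurable.ite {f : ℤ → EuclideanSpace ℝ (Fin n) → ℝ → ℂ} (hf : SeqMeasurable f)
    (P : ℤ → EuclideanSpace ℝ (Fin n) → Prop) [∀ k x, Decidable (P k x)]
    (hP : ∀ k, MeasurableSet {x | P k x}) :
    SeqMeasurable fun k x t => if P k x then f k x t else 0 := by
  classical
  intro k
  have h : Function.uncurry (fun x t => if P k x then f k x t else 0) =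
      (Prod.fst ⁻¹' {x | P k x}).indicator (Function.uncurry (f k)) := by
    ext ⟨x, t⟩
    simp [indicator, Function.uncurry]
  rw [h]
  exact (hf k).indicator (measurable_fst (hP k))

theorem measurableSet_norm_le (A : ℝ) :
    MeasurableSet {x : EuclideanSpace ℝ (Fin n) | ‖x‖ ≤ A} :=
  measurableSet_le measurable_norm measurable_const

theorem SeqMeasurable.cutoff {f : ℤ → EuclideanSpace ℝ (Fin n) → ℝ → ℂ} (hf : SeqMeasurable f)
    (A : ℝ) (N : ℕ) : SeqMeasurable (cutoff A N f) :=
  hf.ite (fun k x => k ∈ Finset.Icc (-(N : ℤ)) N ∧ ‖x‖ ≤ A) fun _ =>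
    (MeasurableSet.const _).inter (measurableSet_norm_le A)

/-- Turns estimates made at almost every fixed x into norm estimates. -/
theorem mixedNorm_cutoff_le (hp : 0 < p) (A : ℝ) (N : ℕ)
    {f : ℤ → EuclideanSpace ℝ (Fin n) → ℝ → ℂ} {F : EuclideanSpace ℝ (Fin n) → ℝ≥0∞}
    (h : ∀ᵐ x, ‖x‖ ≤ A →
      (∫⁻ t in Icc (1 : ℝ) 2, ∑ k ∈ Finset.Icc (-(N : ℤ)) N, ‖f k x t‖ₑ ^ 2) ^ (1 / 2 : ℝ) ≤ F x) :
    mixedNorm p w (cutoff A N f) ≤ weightedNorm p w ({x | ‖x‖ ≤ A}.indicator F) := by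
  refine weightedNorm_mono_ae hp ?_
  filter_upwards [h] with x hx
  by_cases hxA : ‖x‖ ≤ A
  · rw [indicator_of_mem (show x ∈ {x | ‖x‖ ≤ A} from hxA)]
    refine le_trans (le_of_eq ?_) (hx hxA)
    congr 1
    refine lintegral_congr fun t => ?_
    rw [tsum_eq_sum (s := Finset.Icc (-(N : ℤ)) N)]
    · exact Finset.sum_congr rfl fun k hk => by simp only [cutoff, hk, hxA, and_self, if_true]
    · intro k hk
      simp [cutoff, hk]
  · simp [cutoff, hxA]

theorem weightedNorm_indicator_le (hp : 0 < p) (s : Set (EuclideanSpace ℝ (Fin n)))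
    (F : EuclideanSpace ℝ (Fin n) → ℝ≥0∞) :
    weightedNorm p w (s.indicator F) ≤ weightedNorm p w F :=
  weightedNorm_mono_ae hp (Filter.Eventually.of_forall fun x => indicator_le_self s F x)

theorem weightedNorm_const_mul (hp : 0 < p) {c : ℝ≥0∞} (hc : c ≠ ∞)
    (F : EuclideanSpace ℝ (Fin n) → ℝ≥0∞) :
    weightedNorm p w (fun x => c * F x) = c * weightedNorm p w F := by
  unfold weightedNorm
  simp only [ENNReal.mul_rpow_of_nonneg _ _ hp.le]
  rw [lintegral_const_mul' _ _ (ENNReal.rpow_ne_top_of_nonneg hp.le hc),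
    ENNReal.mul_rpow_of_nonneg _ _ (by positivity), ← ENNReal.rpow_mul,
    mul_one_div_cancel hp.ne', ENNReal.rpow_one]

theorem weightedNorm_indicator_const_lt_top (hp : 0 < p) (hw : LocallyIntegrable w volume)
    (A : ℝ) {c : ℝ≥0∞} (hc : c ≠ ∞) :
    weightedNorm p w ({x | ‖x‖ ≤ A}.indicator fun _ => c) < ∞ := by
  have hball : {x : EuclideanSpace ℝ (Fin n) | ‖x‖ ≤ A} = Metric.closedBall 0 A := by
    ext x; simp
  have hfin : (volume.withDensity fun x => ENNReal.ofReal (w x))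
      {x : EuclideanSpace ℝ (Fin n) | ‖x‖ ≤ A} < ∞ := by
    rw [withDensity_apply _ (measurableSet_norm_le A), hball]
    exact (hw.integrableOn_isCompact (isCompact_closedBall 0 A)).lintegral_lt_top
  unfold weightedNorm
  refine ENNReal.rpow_lt_top_of_nonneg (by positivity) (ne_of_lt ?_)
  have h : ∀ x : EuclideanSpace ℝ (Fin n),
      ({x | ‖x‖ ≤ A}.indicator (fun _ => c) x) ^ p = {x | ‖x‖ ≤ A}.indicator (fun _ => c ^ p) x := by
    intro x
    by_cases hx : x ∈ {x : EuclideanSpace ℝ (Fin n) | ‖x‖ ≤ A}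
    · simp only [indicator_of_mem hx]
    · simp only [indicator_of_notMem hx, ENNReal.zero_rpow_of_pos hp]
  simp only [h]
  rw [lintegral_indicator_const (measurableSet_norm_le A)]
  exact ENNReal.mul_lt_top (ENNReal.rpow_lt_top_of_nonneg hp.le hc) hfin

/-- The function that is constant for `π x`, `⌊M t⌋` and `k` fixed, with coefficients `c`. -/
noncomputable def stepFun {R : ℕ} (A : ℝ) (N M : ℕ) (π : EuclideanSpace ℝ (Fin n) → Fin (R + 1))
    (c : Fin (R + 1) × Fin (2 * M + 1) × Fin (2 * N + 1) → ℂ) :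
    ℤ → EuclideanSpace ℝ (Fin n) → ℝ → ℂ :=
  cutoff A N fun k x t => c (π x, Fin.ofNat _ ⌊(M : ℝ) * t⌋₊, Fin.ofNat _ (k + N).toNat)

theorem seqMeasurable_coeff {R M N : ℕ} {π : EuclideanSpace ℝ (Fin n) → Fin (R + 1)}
    (hπ : Measurable π) (c : Fin (R + 1) × Fin (2 * M + 1) × Fin (2 * N + 1) → ℂ) :
    SeqMeasurable fun k x t =>
      c (π x, Fin.ofNat _ ⌊(M : ℝ) * t⌋₊, Fin.ofNat _ (k + N).toNat) := by
  intro k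
  refine Measurable.aestronglyMeasurable ?_
  refine (measurable_of_countable c).comp ((hπ.comp measurable_fst).prodMk
    (Measurable.prodMk ?_ measurable_const))
  exact (measurable_of_countable (Fin.ofNat (2 * M + 1))).comp
    (Nat.measurable_floor.comp (measurable_const.mul measurable_snd))

theorem stepFun_mem [hp : Fact (1 ≤ p)] (hw : LocallyIntegrable w volume) {R : ℕ} (A : ℝ)
    (N M : ℕ) {π : EuclideanSpace ℝ (Fin n) → Fin (R + 1)} (hπ : Measurable π)
    (c : Fin (R + 1) × Fin (2 * M + 1) × Fin (2 * N + 1) → ℂ) :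
    stepFun A N M π c ∈ mixedSubmodule p w := by
  have hp0 : 0 < p := by linarith [hp.out]
  refine ⟨(seqMeasurable_coeff hπ c).cutoff A N, ?_⟩
  let B : ℝ≥0∞ := ∑ i, ‖c i‖ₑ
  have hB : B ≠ ∞ := ENNReal.sum_ne_top.2 fun i _ => enorm_ne_top
  let B' : ℝ≥0∞ :=
    (∫⁻ _ in Icc (1 : ℝ) 2, ∑ _k ∈ Finset.Icc (-(N : ℤ)) N, B ^ 2) ^ (1 / 2 : ℝ)
  have hB' : B' ≠ ∞ := by
    refine (ENNReal.rpow_lt_top_of_nonneg (by norm_num) ?_).ne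
    rw [setLIntegral_const, Finset.sum_const, nsmul_eq_mul]
    exact (ENNReal.mul_lt_top (ENNReal.mul_lt_top (by simp) (ENNReal.pow_lt_top hB.lt_top))
      (by simp)).ne
  refine (mixedNorm_cutoff_le (F := fun _ => B') hp0 A N
    (Filter.Eventually.of_forall fun x _ => ?_)).trans_lt
      (weightedNorm_indicator_const_lt_top hp0 hw A hB')
  refine ENNReal.rpow_le_rpow (lintegral_mono fun t => Finset.sum_le_sum fun k _ => ?_)
    (by norm_num)
  gcongr
  exact Finset.single_le_sum (f := fun i => ‖c i‖ₑ) (fun _ _ => zero_le) (Finset.mem_univ _)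

/-- `stepFun` as a linear map of the coefficients. -/
noncomputable def stepMap [hp : Fact (1 ≤ p)] (hw : LocallyIntegrable w volume) {R : ℕ} (A : ℝ)
    (N M : ℕ) {π : EuclideanSpace ℝ (Fin n) → Fin (R + 1)} (hπ : Measurable π) :
    (Fin (R + 1) × Fin (2 * M + 1) × Fin (2 * N + 1) → ℂ) →ₗ[ℂ] MixedFun p w where
  toFun c := ⟨stepFun A N M π c, stepFun_mem hw A N M hπ c⟩
  map_add' c d := Subtype.ext <| by
    funext k x t
    change stepFun A N M π (c + d) k x t = stepFun A N M π c k x t + stepFun A N M π d k x t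
    simp only [stepFun, cutoff, Pi.add_apply]
    split_ifs <;> simp
  map_smul' r c := Subtype.ext <| by
    funext k x t
    change stepFun A N M π (r • c) k x t = r • stepFun A N M π c k x t
    simp only [stepFun, cutoff, Pi.smul_apply]
    split_ifs <;> simp

/-- Averages in the variable `t` over the cells of length `1 / M`. -/
noncomputable def timeAvg (M : ℕ) (f : ℤ → EuclideanSpace ℝ (Fin n) → ℝ → ℂ) :
    ℤ → EuclideanSpace ℝ (Fin n) → ℝ → ℂ :=
  fun k x t => cellAvg M (f k x) ⌊(M : ℝ) * t⌋₊

theorem cellAvg_eq_zero {M m : ℕ} (hm : 2 * M < m) (g : ℝ → ℂ) : cellAvg M g m = 0 := by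
  have h : cell M m = ∅ := by
    refine eq_empty_of_forall_notMem fun u hu => ?_
    have := floor_le_of_mem (M := M) hu.1
    have := hu.2
    omega
  simp [cellAvg, h]

theorem SeqMeasurable.timeAvg {f : ℤ → EuclideanSpace ℝ (Fin n) → ℝ → ℂ} (hf : SeqMeasurable f)
    (M : ℕ) : SeqMeasurable (timeAvg M f) := by
  intro k
  have h : Function.uncurry (_root_.timeAvg M f k) = fun z => ∑ m ∈ Finset.range (2 * M + 1),
      {z : EuclideanSpace ℝ (Fin n) × ℝ | ⌊(M : ℝ) * z.2⌋₊ = m}.indicator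
        (fun z => cellAvg M (f k z.1) m) z := by
    ext ⟨x, t⟩
    simp only [Function.uncurry, _root_.timeAvg, indicator, mem_ofPred_eq]
    rw [Finset.sum_ite_eq]
    split_ifs with hm
    · rfl
    · exact cellAvg_eq_zero (by simpa using hm) _
  rw [h]
  refine Finset.aestronglyMeasurable_fun_sum _ fun m _ => AEStronglyMeasurable.indicator ?_ ?_
  · have h2 : AEStronglyMeasurable (fun x => cellAvg M (f k x) m) volume := by
      refine AEStronglyMeasurable.const_mul ?_ _
      refine AEStronglyMeasurable.integral_prod_right' (f := Function.uncurry (f k)) ?_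
      refine (hf k).mono_ac (Measure.AbsolutelyContinuous.rfl.prod ?_)
      exact (Measure.restrict_mono_set volume (cell_subset M m)).absolutelyContinuous
    exact h2.comp_fst
  · exact (Nat.measurable_floor.comp (measurable_const.mul measurable_snd))
      (measurableSet_singleton m)

/-- Finite norm gives square-integrable slices almost everywhere for w dx, hence for dx since w > 0
almost everywhere, and L² ⊂ L¹ on [1, 2]. This makes the cell averages of slices genuine. -/
theorem ae_integrableOn (hp : 1 ≤ p) (hw : LocallyIntegrable w volume) (hpos : ∀ᵐ x, 0 < w x)
    {f : ℤ → EuclideanSpace ℝ (Fin n) → ℝ → ℂ} (hf : SeqMeasurable f)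
    (hfin : mixedNorm p w f < ∞) : ∀ᵐ x, ∀ k, IntegrableOn (f k x) (Icc 1 2) := by
  have hp0 : 0 < p := by linarith
  have hac := withDensity_absolutelyContinuous (volume : Measure (EuclideanSpace ℝ (Fin n)))
    (fun x => ENNReal.ofReal (w x))
  have hac' : volume ≪ volume.withDensity fun x => ENNReal.ofReal (w x) := by
    refine withDensity_absolutelyContinuous'
      hw.aestronglyMeasurable.aemeasurable.ennreal_ofReal ?_
    filter_upwards [hpos] with x hx
    simpa using hx
  have h1 : ∀ᵐ x, ((∫⁻ t in Icc (1 : ℝ) 2, ∑' k : ℤ, ‖f k x t‖ₑ ^ 2) ^ (1 / 2 : ℝ)) ^ p < ∞ := by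
    refine hac'.ae_le (ae_lt_top' ((hf.aemeasurable_inner.mono_ac hac).pow_const p) ?_)
    intro h
    rw [mixedNorm, weightedNorm, h, ENNReal.top_rpow_of_pos (by positivity)] at hfin
    exact lt_irrefl _ hfin
  filter_upwards [h1, ae_all_iff.2 fun k => (hf k).prodMk_left] with x hx hm k
  refine ⟨hm k, ?_⟩
  have h2 : ∫⁻ t in Icc (1 : ℝ) 2, ∑' k : ℤ, ‖f k x t‖ₑ ^ 2 < ∞ :=
    (ENNReal.rpow_lt_top_iff_of_pos (by norm_num)).1 ((ENNReal.rpow_lt_top_iff_of_pos hp0).1 hx)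
  have h3 : (∫⁻ t in Icc (1 : ℝ) 2, ‖f k x t‖ₑ) ^ 2 < ∞ := by
    refine (lintegral_sq_le (hm k).enorm).trans_lt (ENNReal.mul_lt_top (by simp) ?_)
    exact (lintegral_mono fun t => ENNReal.le_tsum k).trans_lt h2
  by_contra h4
  rw [HasFiniteIntegral, not_lt, top_le_iff] at h4
  exact absurd h3 (by simp at h4 ⊢; simp [h4])

theorem cellAvg_sub (M m : ℕ) {g h : ℝ → ℂ} (hg : IntegrableOn g (Icc 1 2))
    (hh : IntegrableOn h (Icc 1 2)) :
    cellAvg M g m - cellAvg M h m = cellAvg M (fun u => g u - h u) m := by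
  simp only [cellAvg]
  rw [integral_sub (hg.mono_set (cell_subset M m)) (hh.mono_set (cell_subset M m)), mul_sub]

theorem lintegral_sum_cellAvg_le {M : ℕ} (hM : 0 < M) (K : Finset ℤ) {a b : ℤ → ℝ → ℂ}
    (ha : ∀ k, IntegrableOn (a k) (Icc 1 2)) (hb : ∀ k, IntegrableOn (b k) (Icc 1 2)) :
    ∫⁻ t in Icc (1 : ℝ) 2, ∑ k ∈ K,
        ‖cellAvg M (a k) ⌊(M : ℝ) * t⌋₊ - cellAvg M (b k) ⌊(M : ℝ) * t⌋₊‖ₑ ^ 2 ≤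
      ∫⁻ t in Icc (1 : ℝ) 2, ∑ k ∈ K, ‖a k t - b k t‖ₑ ^ 2 := by
  have hm : ∀ k, AEStronglyMeasurable (fun t => a k t - b k t)
      (volume.restrict (Icc (1 : ℝ) 2)) := fun k =>
    (ha k).aestronglyMeasurable.sub (hb k).aestronglyMeasurable
  simp only [cellAvg_sub M _ (ha _) (hb _)]
  rw [lintegral_finsetSum' _ fun k _ => (hm k).enorm.pow_const 2, lintegral_finsetSum]
  · exact Finset.sum_le_sum fun k _ => lintegral_cellAvg_le hM (hm k)
  · intro k _
    exact (measurable_of_countable fun m : ℕ => ‖cellAvg M (fun u => a k u - b k u) m‖ₑ ^ 2).comp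
      (Nat.measurable_floor.comp (measurable_const.mul measurable_id))

end StepApproximation

/-! ### The three approximation errors. -/

section Approximation

variable {n : ℕ} {p : ℝ} {w : EuclideanSpace ℝ (Fin n) → ℝ}

theorem mixedNorm_sub_le_add (hp : 1 ≤ p) {f g h : ℤ → EuclideanSpace ℝ (Fin n) → ℝ → ℂ}
    (hf : SeqMeasurable f) (hg : SeqMeasurable g) (hh : SeqMeasurable h) :
    mixedNorm p w (f - h) ≤ mixedNorm p w (f - g) + mixedNorm p w (g - h) := by
  rw [← sub_add_sub_cancel f g h]
  exact mixedNorm_add_le hp (fun k => (hf k).sub (hg k)) fun k => (hg k).sub (hh k)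

theorem cutoff_sub (A : ℝ) (N : ℕ) (f g : ℤ → EuclideanSpace ℝ (Fin n) → ℝ → ℂ) :
    cutoff A N f - cutoff A N g = cutoff A N (f - g) := by
  funext k x t
  simp only [cutoff, Pi.sub_apply]
  split_ifs <;> simp

/-- What the cutoff removes is the part with ‖x‖ > A plus the part with ‖x‖ ≤ A and |k| > N; since A
< D, the latter sits in the open ball of radius D. -/
theorem mixedNorm_sub_cutoff_le (hp : 1 ≤ p) {A D : ℝ} (hAD : A < D) (N : ℕ)
    {f : ℤ → EuclideanSpace ℝ (Fin n) → ℝ → ℂ} (hf : SeqMeasurable f) :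
    mixedNorm p w (f - cutoff A N f) ≤
      weightedNorm p w ({x | A < ‖x‖}.indicator fun x =>
        (∫⁻ t in Icc (1 : ℝ) 2, ∑' k : ℤ, ‖f k x t‖ₑ ^ 2) ^ (1 / 2 : ℝ)) +
      weightedNorm p w ((Metric.ball 0 D).indicator fun x =>
        (∫⁻ t in Icc (1 : ℝ) 2, ∑' k : {k : ℤ // (N : ℤ) < |k|},
          ‖f k x t‖ₑ ^ 2) ^ (1 / 2 : ℝ)) := by
  classical
  have hp0 : 0 < p := by linarith
  let far : ℤ → EuclideanSpace ℝ (Fin n) → ℝ → ℂ :=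
    fun k x t => if A < ‖x‖ then f k x t else 0
  let tail : ℤ → EuclideanSpace ℝ (Fin n) → ℝ → ℂ :=
    fun k x t => if k ∉ Finset.Icc (-(N : ℤ)) N ∧ ‖x‖ ≤ A then f k x t else 0
  have hfar : SeqMeasurable far :=
    hf.ite (fun _ x => A < ‖x‖) fun _ => measurableSet_lt measurable_const measurable_norm
  have htail : SeqMeasurable tail :=
    hf.ite (fun k x => k ∉ Finset.Icc (-(N : ℤ)) N ∧ ‖x‖ ≤ A) fun _ =>
      (MeasurableSet.const _).inter (measurableSet_norm_le A)
  have hsplit : f - cutoff A N f = far + tail := by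
    funext k x t
    simp only [far, tail, cutoff, Pi.sub_apply, Pi.add_apply]
    by_cases hx : ‖x‖ ≤ A
    · by_cases hk : k ∈ Finset.Icc (-(N : ℤ)) N <;> simp only [hx, hk, not_lt.2 hx] <;> simp
    · simp [hx, not_le.1 hx]
  rw [hsplit]
  refine (mixedNorm_add_le hp hfar htail).trans (add_le_add ?_ ?_)
  · refine weightedNorm_mono_ae hp0 (Filter.Eventually.of_forall fun x => ?_)
    by_cases hx : A < ‖x‖
    · rw [indicator_of_mem (show x ∈ {x | A < ‖x‖} from hx)]
      simp only [far, hx, if_true, le_refl]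
    · simp [far, hx]
  · refine weightedNorm_mono_ae hp0 (Filter.Eventually.of_forall fun x => ?_)
    by_cases hx : ‖x‖ ≤ A
    · rw [indicator_of_mem (show x ∈ Metric.ball 0 D from
        mem_ball_zero_iff.2 (hx.trans_lt hAD))]
      refine ENNReal.rpow_le_rpow (lintegral_mono fun t => ?_) (by norm_num)
      refine le_trans ?_
        (tsum_subtype {k : ℤ | (N : ℤ) < |k|} fun k => ‖f k x t‖ₑ ^ 2).ge
      refine ENNReal.tsum_le_tsum fun k => ?_
      by_cases hk : (N : ℤ) < |k|
      · rw [indicator_of_mem (show k ∈ {k : ℤ | (N : ℤ) < |k|} from hk)]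
        simp only [tail]
        split_ifs <;> simp
      · have hk' : k ∈ Finset.Icc (-(N : ℤ)) N := Finset.mem_Icc.2 (abs_le.1 (not_lt.1 hk))
        have h0 : tail k x t = 0 := if_neg fun h => h.1 hk'
        simp [h0]
    · simp [tail, hx]

theorem mixedNorm_cutoff_sub_timeAvg_le (hp : 0 < p) (A : ℝ) (N : ℕ) {M : ℕ} (hM : 0 < M)
    {σ : ℝ} (hσ : 1 / (M : ℝ) ≤ σ) {f : ℤ → EuclideanSpace ℝ (Fin n) → ℝ → ℂ}
    (hf : ∀ᵐ x, ∀ k, IntegrableOn (f k x) (Icc 1 2)) :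
    mixedNorm p w (cutoff A N f - cutoff A N (timeAvg M f)) ≤
      2 * weightedNorm p w (fun x => ⨆ (s : ℝ) (_ : |s| ≤ σ),
        (∫⁻ t in {t : ℝ | t ∈ Icc (1 : ℝ) 2 ∧ t + s ∈ Icc (1 : ℝ) 2},
          ∑ k ∈ Finset.Icc (-(N : ℤ)) N,
            ‖f k x (t + s) - f k x t‖ₑ ^ 2) ^ (1 / 2 : ℝ)) := by
  rw [cutoff_sub, ← weightedNorm_const_mul hp (by norm_num)]
  refine (mixedNorm_cutoff_le hp A N ?_).trans (weightedNorm_indicator_le hp _ _)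
  filter_upwards [hf] with x hx _
  set S : ℝ≥0∞ := ⨆ (s : ℝ) (_ : |s| ≤ σ),
    (∫⁻ t in {t : ℝ | t ∈ Icc (1 : ℝ) 2 ∧ t + s ∈ Icc (1 : ℝ) 2},
      ∑ k ∈ Finset.Icc (-(N : ℤ)) N, ‖f k x (t + s) - f k x t‖ₑ ^ 2) ^ (1 / 2 : ℝ) with hS
  have h := lintegral_sub_cellAvg_le hM (Finset.Icc (-(N : ℤ)) N) (a := fun k => f k x) hx
    (S := S ^ (2 : ℝ)) fun s hs => by
      have h1 := le_iSup₂ (f := fun (s : ℝ) (_ : |s| ≤ σ) =>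
        (∫⁻ t in {t : ℝ | t ∈ Icc (1 : ℝ) 2 ∧ t + s ∈ Icc (1 : ℝ) 2},
          ∑ k ∈ Finset.Icc (-(N : ℤ)) N,
            ‖f k x (t + s) - f k x t‖ₑ ^ 2) ^ (1 / 2 : ℝ)) s (hs.trans hσ)
      have h2 := ENNReal.rpow_le_rpow (z := 2) h1 (by norm_num)
      rwa [← ENNReal.rpow_mul, one_div_mul_cancel two_ne_zero, ENNReal.rpow_one] at h2
  calc _ ≤ (2 * S ^ (2 : ℝ)) ^ (1 / 2 : ℝ) := ENNReal.rpow_le_rpow h (by norm_num)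
    -- The sharp factor √2 is rounded up to 2.
    _ ≤ ((2 * S) ^ (2 : ℝ)) ^ (1 / 2 : ℝ) := by
        refine ENNReal.rpow_le_rpow ?_ (by norm_num)
        rw [ENNReal.mul_rpow_of_nonneg _ _ (by norm_num)]
        gcongr
        rw [ENNReal.rpow_two]
        norm_num
    _ = 2 * S := by rw [← ENNReal.rpow_mul]; norm_num

theorem exists_mixedNorm_timeAvg_sub_stepFun_le (hp : 0 < p) {A ρ : ℝ} (N : ℕ) {M R : ℕ}
    (hM : 0 < M) {π : EuclideanSpace ℝ (Fin n) → Fin (R + 1)}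
    (hπ : ∀ x y, ‖x‖ ≤ A → ‖y‖ ≤ A → π x = π y → ‖y - x‖ ≤ ρ)
    {f : ℤ → EuclideanSpace ℝ (Fin n) → ℝ → ℂ}
    (hf : ∀ᵐ x, ∀ k, IntegrableOn (f k x) (Icc 1 2)) :
    ∃ c, mixedNorm p w (cutoff A N (timeAvg M f) - stepFun A N M π c) ≤
      weightedNorm p w (fun x => ⨆ (h : EuclideanSpace ℝ (Fin n)) (_ : ‖h‖ ≤ ρ),
        (∫⁻ t in Icc (1 : ℝ) 2, ∑ k ∈ Finset.Icc (-(N : ℤ)) N,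
          ‖f k x t - f k (x + h) t‖ₑ ^ 2) ^ (1 / 2 : ℝ)) := by
  classical
  -- A representative of each piece, depending on f, at which every slice is integrable; pieces with
  -- no such point get the dummy 0, and almost every x in the ball avoids them.
  have hy : ∀ i, ∃ y : EuclideanSpace ℝ (Fin n),
      (∃ x, ‖x‖ ≤ A ∧ (∀ k, IntegrableOn (f k x) (Icc 1 2)) ∧ π x = i) →
        ‖y‖ ≤ A ∧ (∀ k, IntegrableOn (f k y) (Icc 1 2)) ∧ π y = i := fun i => by
    by_cases h : ∃ x, ‖x‖ ≤ A ∧ (∀ k, IntegrableOn (f k x) (Icc 1 2)) ∧ π x = i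
    · exact ⟨h.choose, fun _ => h.choose_spec⟩
    · exact ⟨0, fun h' => absurd h' h⟩
  choose y hy using hy
  refine ⟨fun i => cellAvg M (f ((i.2.2.val : ℤ) - N) (y i.1)) i.2.1.val, ?_⟩
  rw [stepFun, cutoff_sub]
  refine (mixedNorm_cutoff_le hp A N ?_).trans (weightedNorm_indicator_le hp _ _)
  filter_upwards [hf] with x hx hxA
  obtain ⟨hyA, hyint, hyπ⟩ := hy (π x) ⟨x, hxA, hx, rfl⟩
  refine le_trans ?_ (le_iSup₂ (f := fun (h : EuclideanSpace ℝ (Fin n)) (_ : ‖h‖ ≤ ρ) =>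
        (∫⁻ t in Icc (1 : ℝ) 2, ∑ k ∈ Finset.Icc (-(N : ℤ)) N,
          ‖f k x t - f k (x + h) t‖ₑ ^ 2) ^ (1 / 2 : ℝ)) (y (π x) - x)
          (hπ x (y (π x)) hxA hyA hyπ.symm))
  simp only [add_sub_cancel]
  refine ENNReal.rpow_le_rpow (le_trans (le_of_eq ?_) (lintegral_sum_cellAvg_le hM
    (Finset.Icc (-(N : ℤ)) N) hx hyint)) (by norm_num)
  refine setLIntegral_congr_fun measurableSet_Icc fun t ht => Finset.sum_congr rfl fun k hk => ?_
  -- The reductions modulo 2M + 1 and 2N + 1 have no effect for t ∈ [1, 2] and |k| ≤ N.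
  have h1 : (Fin.ofNat (2 * M + 1) ⌊(M : ℝ) * t⌋₊).val = ⌊(M : ℝ) * t⌋₊ :=
    Nat.mod_eq_of_lt (Nat.lt_succ_of_le (floor_le_of_mem ht))
  have h2 : ((Fin.ofNat (2 * N + 1) (k + N).toNat).val : ℤ) - N = k := by
    have hk' := Finset.mem_Icc.1 hk
    have h3 : (Fin.ofNat (2 * N + 1) (k + N).toNat).val = (k + N).toNat :=
      Nat.mod_eq_of_lt (by omega)
    rw [h3]
    omega
  simp only [Pi.sub_apply, timeAvg, h1, h2]

end Approximation

/-! ### Assembly of the estimates. -/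

theorem lemma3p4 {n : ℕ} (hn : 1 ≤ n) {p : ℝ} [Fact (1 ≤ p)] (hp : 1 < p)
    {w : EuclideanSpace ℝ (Fin n) → ℝ} (hw : IsMuckenhouptWeight p w)
    (G : Set (MixedFun p w))
    -- (a) boundedness
    (ha : ∃ C : ℝ, ∀ f ∈ G, ‖f‖ ≤ C)
    -- (b) uniform decay at spatial infinity
    (hb : ∀ ε : ℝ, 0 < ε → ∃ A : ℝ, 0 < A ∧ ∀ f ∈ G,
      weightedNorm p w ({x | A < ‖x‖}.indicator fun x =>
        (∫⁻ t in Icc (1 : ℝ) 2, ∑' k : ℤ, ‖f k x t‖ₑ ^ 2) ^ (1 / 2 : ℝ)) < ENNReal.ofReal ε)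
    -- (c) uniform equicontinuity in `x`
    (hc : ∀ ε : ℝ, 0 < ε → ∀ N : ℕ, ∃ ρ : ℝ, 0 < ρ ∧ ∀ f ∈ G,
      weightedNorm p w (fun x => ⨆ (h : EuclideanSpace ℝ (Fin n)) (_ : ‖h‖ ≤ ρ),
        (∫⁻ t in Icc (1 : ℝ) 2, ∑ k ∈ Finset.Icc (-(N : ℤ)) N,
          ‖f k x t - f k (x + h) t‖ₑ ^ 2) ^ (1 / 2 : ℝ)) < ENNReal.ofReal ε)
    -- (d) uniform equicontinuity in `t`, only points with `t` and `t + s` in `[1, 2]` being compared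
    (hd : ∀ ε : ℝ, 0 < ε → ∀ N : ℕ, ∃ σ : ℝ, 0 < σ ∧ σ < 1 / 2 ∧ ∀ f ∈ G,
      weightedNorm p w (fun x => ⨆ (s : ℝ) (_ : |s| ≤ σ),
        (∫⁻ t in {t : ℝ | t ∈ Icc (1 : ℝ) 2 ∧ t + s ∈ Icc (1 : ℝ) 2},
          ∑ k ∈ Finset.Icc (-(N : ℤ)) N,
            ‖f k x (t + s) - f k x t‖ₑ ^ 2) ^ (1 / 2 : ℝ)) < ENNReal.ofReal ε)
    -- (e) uniform smallness of the tails `|k| > N` on balls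
    (he : ∀ D : ℝ, 0 < D → ∀ ε : ℝ, 0 < ε → ∃ N : ℕ, ∀ f ∈ G,
      weightedNorm p w ((Metric.ball 0 D).indicator fun x =>
        (∫⁻ t in Icc (1 : ℝ) 2, ∑' k : {k : ℤ // (N : ℤ) < |k|},
          ‖f k x t‖ₑ ^ 2) ^ (1 / 2 : ℝ)) < ENNReal.ofReal ε) :
    IsCompact (closure ((SeparationQuotient.mk : MixedFun p w → MixedSpace p w) '' G)) := by
  have hp1 : (1 : ℝ) ≤ p := hp.le
  have hp0 : 0 < p := by linarith
  have := MixedSpace.completeSpace (p := p) (w := w)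
  refine TotallyBounded.isCompact_of_isClosed (TotallyBounded.closure ?_) isClosed_closure
  obtain ⟨C, hC⟩ := ha
  refine totallyBounded_of_finiteDimensional_approx (C := C) ?_ fun ε hε => ?_
  · rintro _ ⟨f, hf, rfl⟩
    rw [SeparationQuotient.norm_mk]
    exact hC f hf
  -- Five shares: one each for (b), (e) and (c), two for (d) because of the factor 2.
  have hδ : 0 < ε / 5 := by positivity
  obtain ⟨A, hA, hfar⟩ := hb (ε / 5) hδ
  obtain ⟨N, htail⟩ := he (A + 1) (by positivity) (ε / 5) hδ
  obtain ⟨ρ, hρ, hspace⟩ := hc (ε / 5) hδ N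
  obtain ⟨σ, hσ, -, htime⟩ := hd (ε / 5) hδ N
  obtain ⟨M, hMσ⟩ := exists_nat_one_div_lt hσ
  obtain ⟨R, π, hπm, hπ⟩ := exists_finite_label (n := n) A hρ
  let Φ := stepMap (p := p) hw.locallyIntegrable A N (M + 1) hπm
  refine ⟨LinearMap.range
    ((SeparationQuotient.mkCLM ℂ (MixedFun p w)).toLinearMap ∘ₗ Φ), inferInstance, ?_⟩
  rintro _ ⟨f, hf, rfl⟩
  have hfm : SeqMeasurable f := f.2.1
  have hint := ae_integrableOn hp1 hw.locallyIntegrable hw.pos hfm f.2.2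
  obtain ⟨c, hcstep⟩ := exists_mixedNorm_timeAvg_sub_stepFun_le (w := w) hp0 N
    (Nat.succ_pos M) hπ hint
  refine ⟨_, ⟨c, rfl⟩, ?_⟩
  have hnorm : ‖(SeparationQuotient.mk f : MixedSpace p w) -
      ((SeparationQuotient.mkCLM ℂ (MixedFun p w)).toLinearMap ∘ₗ Φ) c‖ = ‖f - Φ c‖ :=
    SeparationQuotient.norm_mk (f - Φ c)
  rw [hnorm, ← ENNReal.ofReal_lt_ofReal_iff hε, MixedFun.enorm_eq]
  have hcut := hfm.cutoff A N
  have havg := (hfm.timeAvg (M + 1)).cutoff A N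
  have hstep : SeqMeasurable (stepFun A N (M + 1) π c) := (seqMeasurable_coeff hπm c).cutoff A N
  have h5 : ENNReal.ofReal ε = (ENNReal.ofReal (ε / 5) + ENNReal.ofReal (ε / 5)) +
      (2 * ENNReal.ofReal (ε / 5) + ENNReal.ofReal (ε / 5)) := by
    rw [← ENNReal.ofReal_ofNat, ← ENNReal.ofReal_mul (by norm_num),
      ← ENNReal.ofReal_add hδ.le hδ.le, ← ENNReal.ofReal_add (by positivity) hδ.le,
      ← ENNReal.ofReal_add (by positivity) (by positivity)]
    congr 1
    ring
  rw [h5]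
  calc mixedNorm p w (f.toFun - stepFun A N (M + 1) π c)
      ≤ mixedNorm p w (f.toFun - cutoff A N f) +
        (mixedNorm p w (cutoff A N f - cutoff A N (timeAvg (M + 1) f)) +
          mixedNorm p w (cutoff A N (timeAvg (M + 1) f) - stepFun A N (M + 1) π c)) :=
        (mixedNorm_sub_le_add hp1 hfm hcut hstep).trans
          (add_le_add le_rfl (mixedNorm_sub_le_add hp1 hcut havg hstep))
    _ < _ := by
        refine ENNReal.add_lt_add ?_ (ENNReal.add_lt_add ?_ ?_)
        · exact (mixedNorm_sub_cutoff_le hp1 (lt_add_one A) N hfm).trans_lt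
            (ENNReal.add_lt_add (hfar f hf) (htail f hf))
        · refine (mixedNorm_cutoff_sub_timeAvg_le hp0 A N (Nat.succ_pos M)
            (by push_cast; exact hMσ.le) hint).trans_lt ?_
          exact (ENNReal.mul_lt_mul_iff_right (by norm_num) (by norm_num)).2 (htime f hf)
        · exact hcstep.trans_lt (hspace f hf)
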